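/- For nonnegative reals $p,q,r,s,t$ with $p+q+r+s+t=1$, let $W=\mathrm{TEC}(p,q,r,s,t)$ denote the tetrahedral erasure channel which, on input $(x_1,x_2)\in\mathbb F_2^2$, outputs $(x_1,x_1+x_2,x_2)$, $(x_1,?,?)$, $(?,x_1+x_2,?)$, $(?,?,x_2)$, $(?,?,?)$ with probabilities $p,q,r,s,t$, respectively. Its entropy and edge mass are \[ H(W)=\frac{q+r+s}{2}+t,\qquad E(W)=q+r+s, \] and, when $0<H(W)<1$, its Quetelet index is $Q(W)=\dfrac{E(W)}{H(W)(1-H(W))}$. The channel $W$ is balanced if $q=r=s$. The serial combination of $U=\mathrm{TEC}(p,q,r,s,t)$ and $V=\mathrm{TEC}(p',q',r',s',t')$ is the TEC whose first four probabilities are \[ pp',\quad pq'+qq'+qp',\quad pr'+rr'+rp',\quad ps'+ss'+sp', \] and whose fifth probability is $1$ minus their sum. The parallel combination of $U$ and $V$ is the TEC whose last four probabilities are \[ tq'+qq'+qt',\quad tr'+rr'+rt',\quad ts'+ss'+st',\quad tt', \] and whose first probability is $1$ minus their sum. For $W=\mathrm{TEC}(p,q,r,s,t)$ let $W\omega=\mathrm{TEC}(p,s,q,r,t)$.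 The serial-child $W^{s}$ and the parallel-child $W^{p}$ of $W$ are the serial combination and the parallel combination, respectively, of $W$ and $W\omega$. \textbf{Lemma (eigenfunction and eigenvalue).} Let $\psi(x)=(x(1-x))^{0.697}\bigl(5-\sqrt{x(1-x)}\bigr)$ for $x\in[0,1]$. For every balanced TEC $W$ with $0<H(W)<1$ and $Q(W)\ge 9/7$, \[ \frac{\psi(H(W^{s}))+\psi(H(W^{p}))}{2\,\psi(H(W))}<0.818. \] -/

import Mathlib

/-- A tetrahedral erasure channel `TEC(p, q, r, s, t)`, given by its subspace erasure probabilities.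
On input `(x₁, x₂)` in `𝔽₂²` the channel outputs
* `(x₁, x₁ + x₂, x₂)` with probability `p`,
* `(x₁, ?, ?)` with probability `q`,
* `(?, x₁ + x₂, ?)` with probability `r`,
* `(?, ?, x₂)` with probability `s`,
* `(?, ?, ?)` with probability `t`. -/
structure TEC where
  p : ℝ
  q : ℝ
  r : ℝ
  s : ℝ
  t : ℝ
  p_nonneg : 0 ≤ p
  q_nonneg : 0 ≤ q
  r_nonneg : 0 ≤ r
  s_nonneg : 0 ≤ s
  t_nonneg : 0 ≤ t
  sum_eq_one : p + q + r + s + t = 1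

namespace TEC

/-- The (conditional) entropy `H(W) = (q + r + s) / 2 + t`. -/
noncomputable def entropy (W : TEC) : ℝ := (W.q + W.r + W.s) / 2 + W.t

/-- The edge mass `E(W) = q + r + s`. -/
def edgeMass (W : TEC) : ℝ := W.q + W.r + W.s

/-- The Quetelet index `Q(W) = E(W) / (H(W) (1 - H(W)))`. -/
noncomputable def quetelet (W : TEC) : ℝ := W.edgeMass / (W.entropy * (1 - W.entropy))

/-- A TEC is balanced if `q = r = s`. -/
def Balanced (W : TEC) : Prop := W.q = W.r ∧ W.r = W.s

/-- The serial combination: the task of guessing `(u₁ + v₁, u₂ + v₂)` from the output of `U` on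
`(u₁, u₂)` and the output of `V` on `(v₁, v₂)`. A nonzero linear form of the sum is known exactly
when both channels reveal it. -/
def serial (U V : TEC) : TEC where
  p := U.p * V.p
  q := U.p * V.q + U.q * V.q + U.q * V.p
  r := U.p * V.r + U.r * V.r + U.r * V.p
  s := U.p * V.s + U.s * V.s + U.s * V.p
  t := 1 - (U.p * V.p + (U.p * V.q + U.q * V.q + U.q * V.p)
    + (U.p * V.r + U.r * V.r + U.r * V.p) + (U.p * V.s + U.s * V.s + U.s * V.p))
  p_nonneg := mul_nonneg U.p_nonneg V.p_nonneg
  q_nonneg := by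
    have := U.p_nonneg; have := U.q_nonneg; have := V.p_nonneg; have := V.q_nonneg
    positivity
  r_nonneg := by
    have := U.p_nonneg; have := U.r_nonneg; have := V.p_nonneg; have := V.r_nonneg
    positivity
  s_nonneg := by
    have := U.p_nonneg; have := U.s_nonneg; have := V.p_nonneg; have := V.s_nonneg
    positivity
  t_nonneg := by
    have := U.p_nonneg; have := U.q_nonneg; have := U.r_nonneg; have := U.s_nonneg
    have := U.t_nonneg
    have := V.p_nonneg; have := V.q_nonneg; have := V.r_nonneg; have := V.s_nonneg
    have := V.t_nonneg
    have h : (U.p + U.q + U.r + U.s + U.t) * (V.p + V.q + V.r + V.s + V.t) = 1 := by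
      rw [U.sum_eq_one, V.sum_eq_one, one_mul]
    have h' : 0 ≤ U.q * (V.r + V.s) + U.r * (V.q + V.s) + U.s * (V.q + V.r)
        + U.t * (V.p + V.q + V.r + V.s + V.t) + (U.p + U.q + U.r + U.s) * V.t := by positivity
    nlinarith [h, h']
  sum_eq_one := by ring

/-- The duality between `TEC(p, q, r, s, t)` and `TEC(t, s, r, q, p)`. It is used only to obtain
the proof fields of the parallel combination. -/
def dual (W : TEC) : TEC where
  p := W.t
  q := W.s
  r := W.r
  s := W.q
  t := W.p
  p_nonneg := W.t_nonneg
  q_nonneg := W.s_nonneg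
  r_nonneg := W.r_nonneg
  s_nonneg := W.q_nonneg
  t_nonneg := W.p_nonneg
  sum_eq_one := by linarith [W.sum_eq_one]

/-- The parallel combination: the task of guessing `(u₁, u₂)` from `(u₁ + v₁, u₂ + v₂)`, the output
of `U` on `(u₁, u₂)` and the output of `V` on `(v₁, v₂)`. -/
def parallel (U V : TEC) : TEC where
  p := 1 - ((U.t * V.q + U.q * V.q + U.q * V.t) + (U.t * V.r + U.r * V.r + U.r * V.t)
    + (U.t * V.s + U.s * V.s + U.s * V.t) + U.t * V.t)
  q := U.t * V.q + U.q * V.q + U.q * V.t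
  r := U.t * V.r + U.r * V.r + U.r * V.t
  s := U.t * V.s + U.s * V.s + U.s * V.t
  t := U.t * V.t
  p_nonneg := by
    have h := (serial U.dual V.dual).t_nonneg
    simp only [serial, dual] at h
    linarith
  q_nonneg := (serial U.dual V.dual).s_nonneg
  r_nonneg := (serial U.dual V.dual).r_nonneg
  s_nonneg := (serial U.dual V.dual).q_nonneg
  t_nonneg := mul_nonneg U.t_nonneg V.t_nonneg
  sum_eq_one := by ring

/-- The channel `Wω` that multiplies its input, an element `x₁ω + x₂` of `𝔽₄`, by the primitive
element `ω` before feeding it into `W`. It is the TEC `TEC(p, s, q, r, t)`. -/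
def twist (W : TEC) : TEC where
  p := W.p
  q := W.s
  r := W.q
  s := W.r
  t := W.t
  p_nonneg := W.p_nonneg
  q_nonneg := W.s_nonneg
  r_nonneg := W.q_nonneg
  s_nonneg := W.r_nonneg
  t_nonneg := W.t_nonneg
  sum_eq_one := by linarith [W.sum_eq_one]

/-- The serial-child of `W`: the serial combination of `W` and `Wω`. -/
def serialChild (W : TEC) : TEC := serial W W.twist

/-- The parallel-child of `W`: the parallel combination of `W` and `Wω`. -/
def parallelChild (W : TEC) : TEC := parallel W W.twist

end TEC

/-- The function `ψ(x) = (x (1 - x)) ^ 0.697 * (5 - √(x (1 - x)))`. -/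
noncomputable def eigenPsi (x : ℝ) : ℝ :=
  (x * (1 - x)) ^ (0.697 : ℝ) * (5 - Real.sqrt (x * (1 - x)))

/-! ### Rational enclosures of real powers -/

/-! Write `x` for the entropy, `E` for the edge mass, `z = x (1 - x)`. For a balanced channel the
children have entropies `x² - E²/12` and `1 - ((1 - x)² - E²/12)`, so a larger `E` moves them apart.
Since `ψ` is concave on `[0, 1]`, spreading lowers the sum of its values
(`ConcaveOn.add_le_add_of_spread`), and the worst case is the least admissible `E = 9/7 · z`, where
`E²/12 = 27/196 · z²`. The symmetry `ψ(1 - x) = ψ(x)` then reduces to `x ≤ 1/2`.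

In that case `z ^ 0.697` factors out of parent and children alike (`eigenPsi_sq_sub`). What remains
is an inequality in `x`, `√z` and the powers 0.697 and 1.197 of two polynomials, the child ratios.
On each of finitely many cells covering `[0, 1/2]`, tangent lines replace the powers, and a chord
and an AM-GM bound enclose `√z`; this leaves rational polynomials whose negativity is computed
(`cell_bound`, `checkChain_cellChain`). -/

/-- With `p = m / n`, raising to the `n`-th power leaves integer exponents; for 697/1000 and
1197/1000 the enclosures become comparisons of natural numbers. -/
lemma rpow_le_of_pow_le {x y p : ℝ} {m n : ℕ} (hx : 0 ≤ x) (hy : 0 ≤ y) (hn : n ≠ 0)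
    (hp : p * n = m) (h : x ^ m ≤ y ^ n) : x ^ p ≤ y := by
  refine le_of_pow_le_pow_left₀ hn hy ?_
  rwa [← Real.rpow_natCast (x ^ p), ← Real.rpow_mul hx, hp, Real.rpow_natCast]

lemma le_rpow_of_pow_le {x y p : ℝ} {m n : ℕ} (hx : 0 ≤ x) (hn : n ≠ 0)
    (hp : p * n = m) (h : y ^ n ≤ x ^ m) : y ≤ x ^ p := by
  refine le_of_pow_le_pow_left₀ hn (Real.rpow_nonneg hx p) ?_
  rwa [← Real.rpow_natCast (x ^ p), ← Real.rpow_mul hx, hp, Real.rpow_natCast]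

/-- Tangent line bound for a concave power. -/
lemma rpow_le_tangent {a a₀ A p : ℝ} (ha : 0 ≤ a) (ha₀ : 0 < a₀) (hp0 : 0 ≤ p) (hp1 : p ≤ 1)
    (hA : a₀ ^ p ≤ A) : a ^ p ≤ A * (1 - p + p / a₀ * a) := by
  have hq : 0 ≤ a / a₀ := by positivity
  have h := rpow_one_add_le_one_add_mul_self (s := a / a₀ - 1) (by linarith) hp0 hp1
  have e : a = a₀ * (a / a₀) := by field_simp
  have h1 : a ^ p = a₀ ^ p * (a / a₀) ^ p := by
    rw [← Real.mul_rpow ha₀.le hq, ← e]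
  have h2 : 1 + (a / a₀ - 1) = a / a₀ := by ring
  have h3 : 1 + p * (a / a₀ - 1) = 1 - p + p / a₀ * a := by ring
  rw [h2, h3] at h
  rw [h1]
  exact mul_le_mul hA h (Real.rpow_nonneg hq p) ((Real.rpow_nonneg ha₀.le p).trans hA)

/-- Tangent line bound for a convex power. -/
lemma tangent_le_rpow {a a₀ A p : ℝ} (ha : 0 ≤ a) (ha₀ : 0 < a₀) (hp1 : 1 ≤ p)
    (hA0 : 0 ≤ A) (hA : A ≤ a₀ ^ p) : A * (1 - p + p / a₀ * a) ≤ a ^ p := by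
  have hq : 0 ≤ a / a₀ := by positivity
  have h := one_add_mul_self_le_rpow_one_add (s := a / a₀ - 1) (by linarith) hp1
  have e : a = a₀ * (a / a₀) := by field_simp
  have h1 : a ^ p = a₀ ^ p * (a / a₀) ^ p := by
    rw [← Real.mul_rpow ha₀.le hq, ← e]
  have h2 : 1 + (a / a₀ - 1) = a / a₀ := by ring
  have h3 : 1 + p * (a / a₀ - 1) = 1 - p + p / a₀ * a := by ring
  rw [h2, h3] at h
  rw [h1]
  exact (mul_le_mul_of_nonneg_left h hA0).trans
    (mul_le_mul_of_nonneg_right hA (Real.rpow_nonneg hq p))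

/-! ### Rational polynomials as coefficient lists -/

namespace CoeffList

/-- The value of a coefficient list at a real number. -/
noncomputable def eval (x : ℝ) : List ℚ → ℝ
  | [] => 0
  | a :: p => a + x * eval x p

def add : List ℚ → List ℚ → List ℚ
  | [], q => q
  | p, [] => p
  | a :: p, b :: q => (a + b) :: add p q

def smul (k : ℚ) (p : List ℚ) : List ℚ := p.map (k * ·)

def mul : List ℚ → List ℚ → List ℚ
  | [], _ => []
  | a :: p, q => add (smul a q) (0 :: mul p q)

/-- An upper bound for the values of a coefficient list on the unit interval. -/
def upperBound : List ℚ → ℚ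
  | [] => 0
  | a :: p => a + max 0 (upperBound p)

lemma eval_add (x : ℝ) (p q : List ℚ) : eval x (add p q) = eval x p + eval x q := by
  induction p, q using add.induct with
  | case1 q => simp [add, eval]
  | case2 p h => cases p <;> simp [add, eval]
  | case3 a p b q ih => simp only [add, eval, ih]; push_cast; ring

lemma eval_smul (x : ℝ) (k : ℚ) (p : List ℚ) : eval x (smul k p) = k * eval x p := by
  induction p with
  | nil => simp [smul, eval]
  | cons a p ih =>
    simp only [smul, List.map_cons, eval] at ih ⊢
    rw [ih]; push_cast; ring

lemma eval_mul (x : ℝ) (p q : List ℚ) : eval x (mul p q) = eval x p * eval x q := by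
  induction p with
  | nil => simp [mul, eval]
  | cons a p ih =>
    simp only [mul, eval_add, eval_smul, eval, ih]; push_cast; ring

/-- Horner's rule: multiplying a tail bounded by `u` by a factor in `[0, 1]` gives at most `max 0
u`. -/
lemma eval_le_upperBound {x : ℝ} (h0 : 0 ≤ x) (h1 : x ≤ 1) (p : List ℚ) :
    eval x p ≤ upperBound p := by
  induction p with
  | nil => simp [eval, upperBound]
  | cons a p ih =>
    simp only [eval, upperBound]
    push_cast
    have h2 : eval x p ≤ max 0 (upperBound p : ℝ) := ih.trans (le_max_right _ _)
    have h3 : x * eval x p ≤ x * max 0 (upperBound p : ℝ) := mul_le_mul_of_nonneg_left h2 h0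
    have h4 : x * max 0 (upperBound p : ℝ) ≤ 1 * max 0 (upperBound p : ℝ) :=
      mul_le_mul_of_nonneg_right h1 (le_max_left _ _)
    linarith

end CoeffList

/-! ### The one-variable inequality -/

/-- With `z = x (1 - x)` and `H = x² - 27/196 z²`, the ratio `H (1 - H) / z` is
`childRatio x (1 - x)`. -/
noncomputable def childRatio (x y : ℝ) : ℝ :=
  x * (1 - 27 / 196 * y ^ 2) * (1 + x + 27 / 196 * x ^ 2 * y)

/-- An interval `[lo, hi]` with tangent points `a, b` for the two child ratios, rational bounds for
their powers of exponents `0.697` and `1.197`, and lower bounds for `√(x (1 - x))` at the ends. -/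
structure Cell where
  lo : ℚ
  hi : ℚ
  a : ℚ
  b : ℚ
  aUp : ℚ
  bUp : ℚ
  aLow : ℚ
  bLow : ℚ
  wlo : ℚ
  whi : ℚ

namespace Cell

open CoeffList

/-- The coefficients of `childRatio`. -/
def ratioList (x y : List ℚ) : List ℚ :=
  mul (mul x (add [1] (smul (-27 / 196) (mul y y))))
    (add [1] (add x (smul (27 / 196) (mul (mul x x) y))))

/-- The upper bound for the difference of the two sides of `cell_bound`, as a polynomial in the
relative position in the cell, when the square root is replaced by `w`. -/
def defect (C : Cell) (w : List ℚ) : List ℚ :=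
  let a := ratioList [C.lo, C.hi - C.lo] [1 - C.lo, C.lo - C.hi]
  let b := ratioList [1 - C.lo, C.lo - C.hi] [C.lo, C.hi - C.lo]
  -- The constants 303/1000 and -197/1000 are `1 - p` for `p = 0.697` and `p = 1.197` in the tangent
  -- lines.
  add (add [-818 / 100]
    (add (smul (5 * C.aUp) (add [303 / 1000] (smul (697 / 1000 / C.a) a)))
      (smul (5 * C.bUp) (add [303 / 1000] (smul (697 / 1000 / C.b) b)))))
    (smul (-1) (mul w (add [-1636 / 1000]
      (add (smul C.aLow (add [-197 / 1000] (smul (1197 / 1000 / C.a) a)))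
        (smul C.bLow (add [-197 / 1000] (smul (1197 / 1000 / C.b) b)))))))

/-- The chord of the semicircle `√(x (1 - x))`. -/
def chord (C : Cell) : List ℚ := [C.wlo, C.whi - C.wlo]

/-- The bound `(x (1 - x) + m²) / (2 m)` for `√(x (1 - x))`, with `m = C.whi`. -/
def mean (C : Cell) : List ℚ :=
  smul (1 / (2 * C.whi))
    (add (mul [C.lo, C.hi - C.lo] [1 - C.lo, C.lo - C.hi]) [C.whi * C.whi])

/-- Decides `x ^ m ≤ y ^ n` for nonnegative rationals by arithmetic in `ℕ`. -/
def powLe (x : ℚ) (m : ℕ) (y : ℚ) (n : ℕ) : Bool :=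
  Nat.ble (Nat.mul (Nat.pow x.num.natAbs m) (Nat.pow y.den n))
    (Nat.mul (Nat.pow y.num.natAbs n) (Nat.pow x.den m))

def check (C : Cell) : Bool :=
  decide (C.lo < C.hi ∧ 0 < C.a ∧ 0 < C.b ∧ 0 ≤ C.aUp ∧ 0 ≤ C.bUp ∧ 0 ≤ C.aLow ∧ 0 ≤ C.bLow
    ∧ 0 ≤ C.wlo ∧ 0 < C.whi ∧ C.wlo * C.wlo ≤ C.lo * (1 - C.lo)
    ∧ C.whi * C.whi ≤ C.hi * (1 - C.hi) ∧ upperBound (C.defect C.chord) < 0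
    ∧ upperBound (C.defect C.mean) < 0)
  && (powLe C.a 697 C.aUp 1000 && powLe C.b 697 C.bUp 1000
    && powLe C.aLow 1000 C.a 1197 && powLe C.bLow 1000 C.b 1197)

/-- Whether a list of cells is valid and joins up from `x` to `1 / 2`. -/
def checkChain (x : ℚ) : List Cell → Bool
  | [] => decide (1 / 2 ≤ x)
  | C :: l => decide (C.lo = x) && C.check && checkChain C.hi l

lemma pow_le_of_powLe {x y : ℚ} {m n : ℕ} (hx : 0 ≤ x) (hy : 0 ≤ y)
    (h : powLe x m y n = true) : (x : ℝ) ^ m ≤ (y : ℝ) ^ n := by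
  have h1 : x.num.natAbs ^ m * y.den ^ n ≤ y.num.natAbs ^ n * x.den ^ m := Nat.le_of_ble_eq_true h
  have cast_eq : ∀ q : ℚ, 0 ≤ q → (q : ℝ) = (q.num.natAbs : ℝ) / (q.den : ℝ) := by
    intro q hq
    have h2 : ((q.num.natAbs : ℤ) : ℝ) = q.num := by
      rw [Int.natAbs_of_nonneg (Rat.num_nonneg.mpr hq)]
    rw [Int.cast_natCast] at h2
    rw [h2, ← Rat.cast_def]
  have hxd : (0 : ℝ) < x.den := by exact_mod_cast x.den_pos
  have hyd : (0 : ℝ) < y.den := by exact_mod_cast y.den_pos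
  rw [cast_eq x hx, cast_eq y hy, div_pow, div_pow, div_le_div_iff₀ (by positivity) (by positivity)]
  exact_mod_cast h1

lemma eval_ratioList (t : ℝ) (x y : List ℚ) :
    eval t (ratioList x y) = childRatio (eval t x) (eval t y) := by
  simp only [ratioList, childRatio, eval_mul, eval_add, eval_smul, eval]
  push_cast
  ring

end Cell

lemma childRatio_nonneg {x y : ℝ} (hx : 0 ≤ x) (hy : 0 ≤ y) (hy1 : y ≤ 1) :
    0 ≤ childRatio x y := by
  have h : 0 ≤ 1 - 27 / 196 * y ^ 2 := by nlinarith
  unfold childRatio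
  positivity

/-- A chord lies below the semicircle `√(x (1 - x))`. -/
lemma chord_le_sqrt {l u v w t : ℝ} (ht0 : 0 ≤ t) (ht1 : t ≤ 1)
    (hv : v * v ≤ l * (1 - l)) (hw : w * w ≤ u * (1 - u)) :
    v + t * (w - v) ≤ √((l + t * (u - l)) * (1 - (l + t * (u - l)))) := by
  apply Real.le_sqrt_of_sq_le
  have h1 : 0 ≤ t * (1 - t) := mul_nonneg ht0 (by linarith)
  have h2 : 0 ≤ t * (1 - t) * (v - w) ^ 2 := by positivity
  have h3 : 0 ≤ t * (1 - t) * (l - u) ^ 2 := by positivity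
  have h4 := mul_le_mul_of_nonneg_left hw ht0
  have h5 := mul_le_mul_of_nonneg_left hv (by linarith : 0 ≤ 1 - t)
  nlinarith

/-- The concave powers enter with a plus sign and are bounded above by tangents; the convex ones
enter with a minus sign and are bounded below. The result is affine in the square root, so checking
it at a lower and an upper bound of the root suffices. -/
lemma cell_bound {C : Cell} (hC : C.check = true) {x : ℝ} (hlo : C.lo ≤ x) (hhi : x ≤ C.hi)
    (hx0 : 0 ≤ x) (hx1 : x ≤ 1) :
    5 * childRatio x (1 - x) ^ (0.697 : ℝ) + 5 * childRatio (1 - x) x ^ (0.697 : ℝ)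
      - √(x * (1 - x)) * (childRatio x (1 - x) ^ (1.197 : ℝ)
        + childRatio (1 - x) x ^ (1.197 : ℝ) - 1.636) < 8.18 := by
  simp only [Cell.check, Bool.and_eq_true, decide_eq_true_eq] at hC
  obtain ⟨⟨hlt, ha, hb, haU, hbU, haL, hbL, hw0, hw1, hws0, hws1, hdef, hdef'⟩,
    ⟨⟨hpa, hpb⟩, hpa'⟩, hpb'⟩ := hC
  have kaU := rpow_le_of_pow_le (p := 0.697) (by exact_mod_cast ha.le) (by exact_mod_cast haU)
    (by norm_num) (by norm_num) (Cell.pow_le_of_powLe ha.le haU hpa)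
  have kbU := rpow_le_of_pow_le (p := 0.697) (by exact_mod_cast hb.le) (by exact_mod_cast hbU)
    (by norm_num) (by norm_num) (Cell.pow_le_of_powLe hb.le hbU hpb)
  have kaL := le_rpow_of_pow_le (p := 1.197) (by exact_mod_cast ha.le)
    (by norm_num) (by norm_num) (Cell.pow_le_of_powLe haL ha.le hpa')
  have kbL := le_rpow_of_pow_le (p := 1.197) (by exact_mod_cast hb.le)
    (by norm_num) (by norm_num) (Cell.pow_le_of_powLe hbL hb.le hpb')
  have ra := childRatio_nonneg hx0 (by linarith : 0 ≤ 1 - x) (by linarith)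
  have rb := childRatio_nonneg (by linarith : 0 ≤ 1 - x) hx0 hx1
  have ta := rpow_le_tangent ra (by exact_mod_cast ha) (by norm_num) (by norm_num) kaU
  have tb := rpow_le_tangent rb (by exact_mod_cast hb) (by norm_num) (by norm_num) kbU
  have sa := tangent_le_rpow ra (by exact_mod_cast ha) (by norm_num) (by exact_mod_cast haL) kaL
  have sb := tangent_le_rpow rb (by exact_mod_cast hb) (by norm_num) (by exact_mod_cast hbL) kbL
  have hlt' : (0 : ℝ) < C.hi - C.lo := by
    have : (C.lo : ℝ) < C.hi := by exact_mod_cast hlt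
    linarith
  obtain ⟨t, ht⟩ : ∃ t : ℝ, x = C.lo + t * (C.hi - C.lo) :=
    ⟨(x - C.lo) / (C.hi - C.lo), by field_simp; ring⟩
  have ht0 : 0 ≤ t := by
    by_contra! h
    nlinarith
  have ht1 : t ≤ 1 := by
    by_contra! h
    nlinarith
  have hchord := chord_le_sqrt (l := C.lo) (u := C.hi) (v := C.wlo) (w := C.whi) ht0 ht1
    (by exact_mod_cast hws0) (by exact_mod_cast hws1)
  rw [← ht] at hchord
  have hw1' : (0 : ℝ) < C.whi := by exact_mod_cast hw1
  -- AM-GM: `2 w m ≤ w² + m²` with `w` the square root and `m = C.whi`.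
  have hmean : √(x * (1 - x)) ≤ 1 / (2 * C.whi) * (x * (1 - x) + C.whi * C.whi) := by
    have h1 : 0 ≤ x * (1 - x) := mul_nonneg hx0 (by linarith)
    rw [one_div_mul_eq_div, le_div_iff₀ (by positivity)]
    nlinarith [sq_nonneg (√(x * (1 - x)) - C.whi), Real.sq_sqrt h1]
  have hev := (CoeffList.eval_le_upperBound ht0 ht1 (C.defect C.chord)).trans_lt
    (by exact_mod_cast hdef : ((CoeffList.upperBound (C.defect C.chord) : ℚ) : ℝ) < 0)
  have hev' := (CoeffList.eval_le_upperBound ht0 ht1 (C.defect C.mean)).trans_lt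
    (by exact_mod_cast hdef' : ((CoeffList.upperBound (C.defect C.mean) : ℚ) : ℝ) < 0)
  have ex : CoeffList.eval t [C.lo, C.hi - C.lo] = x := by
    simp only [CoeffList.eval]; push_cast; rw [ht]; ring
  have ey : CoeffList.eval t [1 - C.lo, C.lo - C.hi] = 1 - x := by
    simp only [CoeffList.eval]; push_cast; rw [ht]; ring
  have ew : CoeffList.eval t C.chord = C.wlo + t * (C.whi - C.wlo) := by
    simp only [CoeffList.eval, Cell.chord]; push_cast; ring
  have em : CoeffList.eval t C.mean = 1 / (2 * C.whi) * (x * (1 - x) + C.whi * C.whi) := by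
    simp only [Cell.mean, CoeffList.eval_add, CoeffList.eval_smul, CoeffList.eval_mul, ex, ey]
    simp only [CoeffList.eval]; push_cast; ring
  simp only [Cell.defect, CoeffList.eval_add, CoeffList.eval_smul, CoeffList.eval_mul,
    Cell.eval_ratioList, ex, ey, ew, em] at hev hev'
  simp only [CoeffList.eval] at hev hev'
  push_cast at hev hev'
  generalize 1 / (2 * (C.whi : ℝ)) * (x * (1 - x) + C.whi * C.whi) = wu at hmean hev'
  generalize (C.wlo : ℝ) + t * (C.whi - C.wlo) = wl at hchord hev
  have m2 := mul_le_mul_of_nonneg_left (add_le_add sa sb) (Real.sqrt_nonneg (x * (1 - x)))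
  generalize √(x * (1 - x)) = w at hmean hchord m2 ⊢
  norm_num at ta tb m2 hev hev' ⊢
  -- The sign of the factor multiplying `w` (409/250 is 1.636) decides which bound is needed: the
  -- chord if it is nonnegative, the mean otherwise.
  rcases le_total 0 (-(409 / 250) + ((C.aLow : ℝ) * (-(197 / 1000)
      + 1197 / 1000 / C.a * childRatio x (1 - x)) + C.bLow * (-(197 / 1000)
      + 1197 / 1000 / C.b * childRatio (1 - x) x))) with hs | hs
  · have m1 := mul_le_mul_of_nonneg_right hchord hs
    linarith
  · have m1 := mul_le_mul_of_nonpos_right hmean hs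
    linarith

/-- A chain of cells that covers `[0, 1/2]`. -/
def cellChain : List Cell :=
  [
   ⟨0, 21/1000, 23/2500, 197/100, 38087/1000000, 100259/62500, 913/250000, 7036/3125, 0, 143383/1000000⟩,
   ⟨21/1000, 1/25, 137/5000, 1913/1000, 20373/250000, 1571649/1000000, 843/62500, 434753/200000, 143383/1000000, 97979/500000⟩,
   ⟨1/25, 27/500, 431/10000, 933/500, 111747/1000000, 772317/500000, 11599/500000, 2109993/1000000, 97979/500000, 226017/1000000⟩,
   ⟨27/500, 8/125, 549/10000, 229/125, 132277/1000000, 1524963/1000000, 1937/62500, 258007/125000, 226017/1000000, 15297/62500⟩,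
   ⟨8/125, 37/500, 13/200, 451/250, 93/625, 37717/25000, 2371/62500, 126647/62500, 15297/62500, 26177/100000⟩,
   ⟨37/500, 21/250, 753/10000, 222/125, 32973/200000, 9327/6250, 45239/1000000, 1988763/1000000, 26177/100000, 277387/1000000⟩,
   ⟨21/250, 97/1000, 7/80, 218/125, 36611/200000, 1473527/1000000, 54147/1000000, 1945947/1000000, 277387/1000000, 295957/1000000⟩,
   ⟨97/1000, 29/250, 21/200, 17/10, 10393/50000, 289503/200000, 67353/1000000, 1887327/1000000, 295957/1000000, 10007/31250⟩,
   ⟨29/250, 73/500, 133/1000, 204/125, 24509/100000, 140691/100000, 89381/1000000, 898661/500000, 10007/31250, 70621/200000⟩,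
   ⟨73/500, 19/100, 89/500, 383/250, 75073/250000, 1077/800, 31673/250000, 333261/200000, 70621/200000, 3923/10000⟩,
   ⟨19/100, 249/1000, 123/500, 279/200, 5879/15625, 252231/200000, 37323/200000, 29791/20000, 3923/10000, 432433/1000000⟩,
   ⟨249/1000, 77/250, 333/1000, 1243/1000, 46467/100000, 232743/200000, 134071/500000, 1297423/1000000, 432433/1000000, 230833/500000⟩,
   ⟨77/250, 359/1000, 421/1000, 1107/1000, 273587/500000, 67089/62500, 35503/100000, 1129391/1000000, 230833/500000, 239853/500000⟩,
   ⟨359/1000, 401/1000, 501/1000, 997/1000, 308857/500000, 997909/1000000, 17489/40000, 996409/1000000, 239853/500000, 4901/10000⟩,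
   ⟨401/1000, 109/250, 143/250, 909/1000, 338747/500000, 935663/1000000, 64049/125000, 892073/1000000, 4901/10000, 247943/500000⟩,
   ⟨109/250, 233/500, 317/500, 837/1000, 5823/8000, 176673/200000, 289781/500000, 101021/125000, 247943/500000, 249421/500000⟩,
   ⟨233/500, 247/500, 173/250, 387/500, 193417/250000, 33459/40000, 321793/500000, 367953/500000, 249421/500000, 499963/1000000⟩,
   ⟨247/500, 1/2, 363/500, 739/1000, 799969/1000000, 809927/1000000, 681617/1000000, 696253/1000000, 499963/1000000, 1/2⟩]

/-- The whole numerical content of the theorem. The tangent points in the cells are rounded child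
ratios near the cell midpoints. -/
lemma checkChain_cellChain : Cell.checkChain 0 cellChain = true := by decide +kernel

lemma chain_bound {l : List Cell} {y : ℚ} (hl : Cell.checkChain y l = true) {x : ℝ}
    (hy : y < x) (hx0 : 0 ≤ x) (hx1 : x ≤ 1 / 2) :
    5 * childRatio x (1 - x) ^ (0.697 : ℝ) + 5 * childRatio (1 - x) x ^ (0.697 : ℝ)
      - √(x * (1 - x)) * (childRatio x (1 - x) ^ (1.197 : ℝ)
        + childRatio (1 - x) x ^ (1.197 : ℝ) - 1.636) < 8.18 := by
  induction l generalizing y with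
  | nil =>
    have h : (1 / 2 : ℚ) ≤ y := by simpa [Cell.checkChain] using hl
    have h' : ((1 / 2 : ℚ) : ℝ) ≤ y := by exact_mod_cast h
    push_cast at h'
    linarith
  | cons C l ih =>
    simp only [Cell.checkChain, Bool.and_eq_true, decide_eq_true_eq] at hl
    obtain ⟨⟨hlo, hC⟩, hrest⟩ := hl
    rcases le_or_gt x C.hi with h | h
    · exact cell_bound hC (by rw [hlo]; exact hy.le) h hx0 (by linarith)
    · exact ih hrest h

/-! ### Concavity of the eigenfunction -/

/-- The function with `eigenPsi x = rootPsi (x (1 - x))`. -/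
noncomputable def rootPsi (z : ℝ) : ℝ := z ^ (0.697 : ℝ) * (5 - √z)

lemma eigenPsi_eq (x : ℝ) : eigenPsi x = rootPsi (x * (1 - x)) := rfl

lemma eigenPsi_one_sub (x : ℝ) : eigenPsi (1 - x) = eigenPsi x := by
  rw [eigenPsi_eq, eigenPsi_eq]; congr 1; ring

lemma rpow_mul_sqrt {z : ℝ} (hz : 0 ≤ z) : z ^ (0.697 : ℝ) * √z = z ^ (1.197 : ℝ) := by
  rw [Real.sqrt_eq_rpow, ← Real.rpow_add' hz (by norm_num)]
  norm_num

lemma rootPsi_eq {z : ℝ} (hz : 0 ≤ z) :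
    rootPsi z = 5 * z ^ (0.697 : ℝ) - z ^ (1.197 : ℝ) := by
  rw [rootPsi, mul_sub, rpow_mul_sqrt hz]; ring

/-- A concave power minus a convex one. -/
lemma concaveOn_rootPsi : ConcaveOn ℝ (Set.Ici 0) rootPsi := by
  have h1 : ConcaveOn ℝ (Set.Ici 0) fun z : ℝ => z ^ (0.697 : ℝ) :=
    Real.concaveOn_rpow (by norm_num) (by norm_num)
  have h2 : ConvexOn ℝ (Set.Ici 0) fun z : ℝ => z ^ (1.197 : ℝ) := convexOn_rpow (by norm_num)
  refine ((h1.smul (by norm_num : (0 : ℝ) ≤ 5)).sub h2).congr ?_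
  intro z hz
  simp [rootPsi_eq (Set.mem_Ici.mp hz)]

lemma rootPsi_mono {y z : ℝ} (hy : 0 ≤ y) (hyz : y ≤ z) (hz : z ≤ 1 / 4) :
    rootPsi y ≤ rootPsi z := by
  -- Splitting 0.697 as 0.197 + 1/2 leaves two increasing factors: `s (5 - s)` increases for `s ≤
  -- 5/2`, and here `s = √u ≤ 1/2`.
  have key : ∀ u : ℝ, 0 ≤ u → rootPsi u = u ^ (0.197 : ℝ) * (√u * (5 - √u)) := by
    intro u hu
    rw [rootPsi, ← mul_assoc, Real.sqrt_eq_rpow, ← Real.rpow_add' hu (by norm_num)]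
    norm_num
  rw [key y hy, key z (hy.trans hyz)]
  have h1 : √y ≤ √z := Real.sqrt_le_sqrt hyz
  have h2 : √z ≤ 1 / 2 := by
    rw [Real.sqrt_le_left (by norm_num)]; norm_num; linarith
  have h0 := Real.sqrt_nonneg y
  refine mul_le_mul (Real.rpow_le_rpow hy hyz (by norm_num)) (by nlinarith) ?_
    (Real.rpow_nonneg (hy.trans hyz) _)
  exact mul_nonneg h0 (by linarith)

/-- A concave function, increasing on `[0, 1/4]`, composed with the concave `x (1 - x)`, whose
values on `[0, 1]` lie there. -/
lemma concaveOn_eigenPsi : ConcaveOn ℝ (Set.Icc 0 1) eigenPsi := by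
  refine ⟨convex_Icc 0 1, ?_⟩
  intro x hx y hy a b ha hb hab
  have hx' : 0 ≤ x * (1 - x) := mul_nonneg hx.1 (by linarith [hx.2])
  have hy' : 0 ≤ y * (1 - y) := mul_nonneg hy.1 (by linarith [hy.2])
  have h := concaveOn_rootPsi.2 (Set.mem_Ici.mpr hx') (Set.mem_Ici.mpr hy') ha hb hab
  simp only [smul_eq_mul] at h ⊢
  rw [eigenPsi_eq, eigenPsi_eq, eigenPsi_eq]
  refine h.trans (rootPsi_mono (by positivity) ?_ ?_)
  · obtain rfl : b = 1 - a := by linarith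
    nlinarith [mul_nonneg (mul_nonneg ha hb) (sq_nonneg (x - y))]
  · nlinarith [sq_nonneg (a * x + b * y - 1 / 2)]

/-- Spreading two points apart decreases the sum of the values of a concave function. -/
lemma ConcaveOn.add_le_add_of_spread {s : Set ℝ} {f : ℝ → ℝ} (hf : ConcaveOn ℝ s f)
    {u v d : ℝ} (hd : 0 ≤ d) (huv : u ≤ v) (hu : u - d ∈ s) (hv : v + d ∈ s) :
    f (u - d) + f (v + d) ≤ f u + f v := by
  rcases (by linarith : 0 ≤ v + d - (u - d)).eq_or_lt with h | h
  · obtain rfl : d = 0 := by linarith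
    simp
  -- Both `u` and `v` are convex combinations of the outer points, with the same two weights
  -- interchanged, so the two concavity inequalities add up to the claim.
  · have hb : 0 ≤ d / (v + d - (u - d)) := by positivity
    have ha : 0 ≤ (v + d - u) / (v + d - (u - d)) := div_nonneg (by linarith) h.le
    have hab : (v + d - u) / (v + d - (u - d)) + d / (v + d - (u - d)) = 1 := by
      field_simp; ring
    have h1 := hf.2 hu hv ha hb hab
    have h2 := hf.2 hu hv hb ha (by linarith)
    have e1 : (v + d - u) / (v + d - (u - d)) * (u - d) + d / (v + d - (u - d)) * (v + d) = u := by
      field_simp; ring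
    have e2 : d / (v + d - (u - d)) * (u - d) + (v + d - u) / (v + d - (u - d)) * (v + d) = v := by
      field_simp; ring
    simp only [smul_eq_mul, e1, e2] at h1 h2
    linear_combination h1 + h2 - (f (u - d) + f (v + d)) * hab

/-! ### The eigenvalue bound -/

lemma rootPsi_mul {z a : ℝ} (hz : 0 ≤ z) (ha : 0 ≤ a) :
    rootPsi (z * a) = z ^ (0.697 : ℝ) * (5 * a ^ (0.697 : ℝ) - √z * a ^ (1.197 : ℝ)) := by
  rw [rootPsi, Real.mul_rpow hz ha, Real.sqrt_mul hz, ← rpow_mul_sqrt ha]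
  ring

/-- Both `h = x² - 27/196 (x y)²` and `1 - h` factor: `x²` divides the first, and `y` the second
because `1 - x² = y (1 + x)`. Hence `h (1 - h)` is `x y` times the child ratio. -/
lemma eigenPsi_sq_sub {x y : ℝ} (hx : 0 ≤ x) (hy : 0 ≤ y) (hxy : x + y = 1) :
    eigenPsi (x ^ 2 - 27 / 196 * (x * y) ^ 2) = (x * y) ^ (0.697 : ℝ)
      * (5 * childRatio x y ^ (0.697 : ℝ) - √(x * y) * childRatio x y ^ (1.197 : ℝ)) := by
  rw [← rootPsi_mul (mul_nonneg hx hy) (childRatio_nonneg hx hy (by linarith)), eigenPsi_eq]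
  obtain rfl : y = 1 - x := by linarith
  congr 1
  unfold childRatio
  ring

/-- The eigenvalue bound for the least admissible edge mass. -/
lemma eigenPsi_add_lt_of_le_half {x : ℝ} (hx0 : 0 < x) (hx1 : x ≤ 1 / 2) :
    eigenPsi (x ^ 2 - 27 / 196 * (x * (1 - x)) ^ 2)
      + eigenPsi ((1 - x) ^ 2 - 27 / 196 * (x * (1 - x)) ^ 2) < 1.636 * eigenPsi x := by
  have h := chain_bound checkChain_cellChain (by simpa using hx0) hx0.le hx1
  have h1 := eigenPsi_sq_sub (y := 1 - x) hx0.le (by linarith) (by ring)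
  have h2 := eigenPsi_sq_sub (x := 1 - x) (y := x) (by linarith) hx0.le (by ring)
  rw [mul_comm (1 - x) x] at h2
  have hz : 0 < (x * (1 - x)) ^ (0.697 : ℝ) :=
    Real.rpow_pos_of_pos (mul_pos hx0 (by linarith)) _
  rw [h1, h2, eigenPsi]
  nlinarith [mul_lt_mul_of_pos_left h hz]

lemma eigenPsi_add_lt {x d : ℝ} (hx0 : 0 < x) (hx1 : x < 1)
    (hd : 27 / 196 * (x * (1 - x)) ^ 2 ≤ d) (hd1 : d ≤ x ^ 2) (hd2 : d ≤ (1 - x) ^ 2) :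
    eigenPsi (x ^ 2 - d) + eigenPsi ((1 - x) ^ 2 - d) < 1.636 * eigenPsi x := by
  have hmin : eigenPsi (x ^ 2 - 27 / 196 * (x * (1 - x)) ^ 2)
      + eigenPsi ((1 - x) ^ 2 - 27 / 196 * (x * (1 - x)) ^ 2) < 1.636 * eigenPsi x := by
    rcases le_total x (1 / 2) with h | h
    · exact eigenPsi_add_lt_of_le_half hx0 h
    · have h1 := eigenPsi_add_lt_of_le_half (x := 1 - x) (by linarith) (by linarith)
      rw [sub_sub_cancel, mul_comm (1 - x) x, eigenPsi_one_sub x] at h1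
      linarith
  refine lt_of_le_of_lt ?_ hmin
  set c := 27 / 196 * (x * (1 - x)) ^ 2 with hc
  have hc0 : 0 ≤ c := by positivity
  have hsq : x ^ 2 ≤ 1 := by nlinarith
  have hsq' : (1 - x) ^ 2 ≤ 1 := by nlinarith
  -- The second point is reflected by `y ↦ 1 - y`, which preserves `ψ`; subtracting more from both
  -- entropies then becomes a symmetric spread.
  have h := concaveOn_eigenPsi.add_le_add_of_spread (u := x ^ 2 - c) (v := 1 - ((1 - x) ^ 2 - c))
    (d := d - c) (by linarith) (by nlinarith) ⟨by linarith, by linarith⟩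
    ⟨by linarith, by linarith⟩
  rw [eigenPsi_one_sub, show x ^ 2 - c - (d - c) = x ^ 2 - d by ring,
    show 1 - ((1 - x) ^ 2 - c) + (d - c) = 1 - ((1 - x) ^ 2 - d) by ring, eigenPsi_one_sub] at h
  exact h

/-! ### Entropies of the children of a balanced channel -/

namespace TEC

/-- A balanced channel equals its twist. With `q = E/3`, completing the square gives `3/2 (2 t q +
q²) + t² = (t + 3 q / 2)² - 3 q² / 4`. -/
lemma entropy_parallelChild {W : TEC} (hbal : W.Balanced) :
    W.parallelChild.entropy = W.entropy ^ 2 - W.edgeMass ^ 2 / 12 := by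
  obtain ⟨hqr, hrs⟩ := hbal
  simp only [parallelChild, parallel, twist, entropy, edgeMass, hqr, hrs]
  ring

/-- The parallel formula under duality, which exchanges `p` with `t`, replaces the entropy by its
complement and keeps the edge mass. -/
lemma entropy_serialChild {W : TEC} (hbal : W.Balanced) :
    W.serialChild.entropy = 1 - ((1 - W.entropy) ^ 2 - W.edgeMass ^ 2 / 12) := by
  obtain ⟨hqr, hrs⟩ := hbal
  have hp : W.p = 1 - 3 * W.s - W.t := by linarith [W.sum_eq_one]
  simp only [serialChild, serial, twist, entropy, edgeMass, hqr, hrs, hp]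
  ring

end TEC

theorem mainTheorem2 (W : TEC) (hbal : W.Balanced) (hQ : 9 / 7 ≤ W.quetelet) :
    (eigenPsi W.serialChild.entropy + eigenPsi W.parallelChild.entropy)
      / (2 * eigenPsi W.entropy) < 0.818 := by
  have hq := W.q_nonneg
  have hr := W.r_nonneg
  have hs := W.s_nonneg
  have ht := W.t_nonneg
  have hp := W.p_nonneg
  have hsum := W.sum_eq_one
  have he0 : 0 ≤ W.edgeMass := by unfold TEC.edgeMass; positivity
  have he1 : W.edgeMass ≤ 2 * W.entropy := by unfold TEC.edgeMass TEC.entropy; linarith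
  have he2 : W.edgeMass ≤ 2 * (1 - W.entropy) := by unfold TEC.edgeMass TEC.entropy; linarith
  -- At entropy 0 or 1 the quotient defining the Quetelet index has the default value 0, below 9/7;
  -- so `hQ` already forces entropy strictly between 0 and 1.
  have hne : W.entropy * (1 - W.entropy) ≠ 0 := by
    intro h
    rw [TEC.quetelet, h, div_zero] at hQ
    norm_num at hQ
  have hx0 : 0 < W.entropy :=
    lt_of_le_of_ne (by linarith) fun h => hne (by rw [← h, zero_mul])
  have hx1 : W.entropy < 1 :=
    lt_of_le_of_ne (by linarith) fun h => hne (by rw [h, sub_self, mul_zero])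
  have hz : 0 < W.entropy * (1 - W.entropy) := mul_pos hx0 (by linarith)
  have hQe : 9 / 7 * (W.entropy * (1 - W.entropy)) ≤ W.edgeMass := (le_div_iff₀ hz).mp hQ
  -- `(9/7)² / 12 = 27/196`; the upper bounds on `d` follow from `E ≤ 2 H` and `E ≤ 2 (1 - H)`.
  have hlt := eigenPsi_add_lt (d := W.edgeMass ^ 2 / 12) hx0 hx1
    (by nlinarith [pow_le_pow_left₀ (by positivity) hQe 2])
    (by nlinarith [pow_le_pow_left₀ he0 he1 2]) (by nlinarith [pow_le_pow_left₀ he0 he2 2])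
  have hpsi : 0 < eigenPsi W.entropy := by
    have h1 : √(W.entropy * (1 - W.entropy)) < 5 := by
      rw [Real.sqrt_lt' (by norm_num)]
      nlinarith
    exact mul_pos (Real.rpow_pos_of_pos hz _) (by linarith)
  rw [TEC.entropy_serialChild hbal, TEC.entropy_parallelChild hbal, eigenPsi_one_sub,
    div_lt_iff₀ (by positivity)]
  linarith
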